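/- There are an absolute constant $c>0$ and a polynomial $P$ such that the following holds for all $d,k\in\mathbb N$, every finite set $A\subset\mathbb R^d$ with $n=|A|$, and all $\beta,\varepsilon>0$. For a set $F\subseteq\mathbb R^d$ consider the $k$-means instance $(A,F,\|\cdot\|^2,k)$ with clients $A$ and candidate centers $F$. A nonempty finite set $T$ of centers has cost $\mathrm{cost}(A,T)=\sum_{x\in A}\min_{c\in T}\|x-c\|^2$, and $\mathrm{OPT}_F$ denotes the infimum of $\mathrm{cost}(A,T)$ over all nonempty $T\subseteq F$ with $|T|\le k$. A clustering $C=\{C_1,\dots,C_k\}$ (a partition of $A$ into $k$ nonempty sets) with $k$ distinct centers $S=\{c_1,\dots,c_k\}\subseteq F$ has cost $\mathrm{cost}(C,S)=\sum_{i=1}^k\sum_{x\in C_i}\|x-c_i\|^2$, and $(C,S)$ is called $\beta$-distribution stable in $(A,F,\|\cdot\|^2,k)$ if $\|x-c_j\|^2\ge\beta\,\mathrm{OPT}_F/|C_j|$ for all $i\ne j$ and all $x\in C_i$. Then there is a finite set $F\subset\mathbb R^d$ of at most $n^{P(1/\varepsilon)}$ candidate centers such that for every clustering $C$ of $A$ with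 centers $S=\{c_1,\dots,c_k\}\subset\mathbb R^d$ for which $(C,S)$ is $\beta$-distribution stable in $(A,\mathbb R^d,\|\cdot\|^2,k)$, there is a set $S'=\{c'_1,\dots,c'_k\}\subseteq F$ of $k$ distinct centers such that $(C,S')$ is $c\beta$-distribution stable in the discrete instance $(A,F,\|\cdot\|^2,k)$, $\mathrm{cost}(C,S')\le(1+\varepsilon)\,\mathrm{cost}(C,S)$, and $\mathrm{cost}(A,S')\le(1+\varepsilon)\,\mathrm{cost}(A,S)$. -/

import Mathlib

namespace KClustering

/-- The cost `∑_{x ∈ A} min_{c ∈ T} cost(x, c)` of serving each client of `A` by its cheapest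
center in `T`; used only for nonempty `T`. -/
noncomputable def solutionCost {X : Type*} (cost : X → X → ℝ) (A T : Finset X) : ℝ :=
  ∑ x ∈ A, ⨅ c : T, cost x c

/-- `OPT`: the optimal value of the `k`-clustering instance `(A, F, cost, k)`, that is, the infimum
of the costs of the nonempty sets of at most `k` centers from `F`. -/
noncomputable def opt {X : Type*} (cost : X → X → ℝ) (A : Finset X) (F : Set X) (k : ℕ) : ℝ :=
  sInf {v : ℝ | ∃ T : Finset X, T.Nonempty ∧ (T : Set X) ⊆ F ∧ T.card ≤ k ∧
    v = solutionCost cost A T}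

/-- `C 0, …, C (k-1)` is a partition of the client set `A` into `k` nonempty clusters. -/
structure IsClustering {X : Type*} (A : Finset X) {k : ℕ} (C : Fin k → Finset X) : Prop where
  nonempty : ∀ i, (C i).Nonempty
  disjoint : ∀ i j, i ≠ j → Disjoint (C i) (C j)
  mem_iff : ∀ x, x ∈ A ↔ ∃ i, x ∈ C i

/-- The cost `∑_i ∑_{x ∈ C_i} cost(x, s_i)` of the clustering `C` with centers `s`. -/
noncomputable def clusteringCost {X : Type*} (cost : X → X → ℝ) {k : ℕ}
    (C : Fin k → Finset X) (s : Fin k → X) : ℝ :=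
  ∑ i, ∑ x ∈ C i, cost x (s i)

/-- The clustering `C` with `k` distinct centers `s` taken from `F` is `β`-distribution stable in
the instance `(A, F, cost, k)`: every client outside `C j` pays at least `β · OPT / |C j|` for being
assigned to the center of `C j`. -/
structure IsDistributionStable {X : Type*} (cost : X → X → ℝ) (A : Finset X) (F : Set X) (k : ℕ)
    (β : ℝ) (C : Fin k → Finset X) (s : Fin k → X) : Prop where
  isClustering : IsClustering A C
  center_mem : ∀ i, s i ∈ F
  center_injective : Function.Injective s
  stable : ∀ i j, i ≠ j → ∀ x ∈ C i, β * (opt cost A F k / ((C j).card : ℝ)) ≤ cost x (s j)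

/-- The set `{s_1, …, s_k}` of centers of a family. -/
noncomputable def centerSet {X : Type*} {k : ℕ} (s : Fin k → X) : Finset X :=
  (Set.finite_range s).toFinset

/-- The `k`-means cost function `‖x - c‖²` on `d`-dimensional Euclidean space. -/
noncomputable def sqCost {d : ℕ} (x c : EuclideanSpace ℝ (Fin d)) : ℝ := ‖x - c‖ ^ 2

end KClustering

/-!
The net `F` comes from a finite code for centers: two centers with the same code are almost equally
good for every client, so one representative of each code suffices, and there are only
`n ^ poly(1 / ε)` codes.

Let `x₀` be the client nearest to a center `c`, let `r = ‖c - x₀‖`, and let `û` be the direction of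
`c - x₀`. The squared distance from `c` to a client `x` is determined by `‖x - x₀‖`, `r`, and the
inner product of `û` with the direction of `x - x₀`. Because `r ≤ ‖x - c‖`, it is enough to know
these inner products up to an error `e`, a small multiple of `min ε 1`. The dimension-free bound
for this is dual Sudakov covering: a greedy walk with steps `± e • w`, where `w` is the direction
of a client, reaches a good approximation of `û` after `O(1 / e ^ 2)` steps (`exists_greedy_net`),
which leaves `n ^ O(1 / e ^ 2)` possibilities.

The radius `r` is unbounded and is recorded only relative to finitely many scales: the distances
`‖x - x₀‖`, the distances `√(β * OPT / m)` that matter for stability, and a small slack `δ`. Within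
a factor `1 / e` of some scale, a geometric grid fixes `r` up to the factor `1 + e`; if `r` lies in
a gap between scales, every client and every threshold is negligible or dominant
(`scaleGrid_trichotomy`), and a representative of almost minimal radius works for the whole gap
(`isSubstitute_of_same_code`). Choosing an actual center as the representative of a code, rather
than the end point of the walk, is what keeps the distances from becoming too small, as stability
requires. This gives `exists_substitute_net`.

Different centers can have the same code, so small translations are added to the net to make the
new centers distinct (`exists_injective_perturbation`). The resulting additive errors are absorbed
because `OPT > 0` when there are fewer clusters than clients (`opt_pos`). When there are equally
many, the clients themselves are the centers (`exists_singleton_centers`).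
-/

namespace KClustering

/-! ### A greedy net for finitely many linear functionals -/

/-- Dual Sudakov covering by a greedy argument: start at `0`, and as long as some functional
`⟪w i, ·⟫` distinguishes `u` from the current point by more than `e`, move by `± e • w i`. Each move
lowers the squared distance to `u` by at least `e ^ 2`, so that more than `1 / e ^ 2` moves are
never needed, and a move has only `3 * |I|` choices (the sign `0` stands for a move not made). -/
theorem exists_greedy_net {ι E : Type*} [NormedAddCommGroup E] [InnerProductSpace ℝ E]
    {I : Finset ι} (hI : I.Nonempty) (w : ι → E) (hw : ∀ i ∈ I, ‖w i‖ ≤ 1) {e : ℝ}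
    (he : 0 < e) (t : ℕ) :
    ∃ S : Finset E, S.card ≤ (3 * I.card) ^ t ∧ ∀ u : E, ‖u‖ ≤ 1 → ∃ g ∈ S,
      (∀ i ∈ I, |inner ℝ (w i) (u - g)| ≤ e) ∨ ‖u - g‖ ^ 2 ≤ 1 - t * e ^ 2 := by
  classical
  induction t with
  | zero =>
    refine ⟨{0}, by simp, fun u hu => ⟨0, by simp, Or.inr ?_⟩⟩
    simp only [sub_zero, Nat.cast_zero, zero_mul]
    exact pow_le_one₀ (norm_nonneg u) hu
  | succ t ih =>
    obtain ⟨S, hS, h⟩ := ih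
    refine ⟨(S ×ˢ (I ×ˢ (Finset.univ : Finset SignType))).image
      (fun p => p.1 + ((e * ((p.2.2 : SignType) : ℝ)) • w p.2.1)), ?_, ?_⟩
    · refine Finset.card_image_le.trans ?_
      rw [Finset.card_product, Finset.card_product, pow_succ]
      have : (Finset.univ : Finset SignType).card = 3 := by decide
      rw [this, mul_comm I.card 3]
      exact Nat.mul_le_mul_right _ hS
    · intro u hu
      obtain ⟨g, hg, hgu⟩ := h u hu
      by_cases hgood : ∀ i ∈ I, |inner ℝ (w i) (u - g)| ≤ e
      · obtain ⟨i, hi⟩ := hI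
        refine ⟨g, ?_, Or.inl hgood⟩
        simp only [Finset.mem_image, Finset.mem_product, Finset.mem_univ, and_true]
        exact ⟨(g, i, 0), ⟨hg, hi⟩, by simp⟩
      · have hb := hgu.resolve_left hgood
        push Not at hgood
        obtain ⟨i, hi, hlt⟩ := hgood
        set a : ℝ := inner ℝ (w i) (u - g) with ha
        refine ⟨g + (e * ((SignType.sign a : SignType) : ℝ)) • w i, ?_, Or.inr ?_⟩
        · simp only [Finset.mem_image, Finset.mem_product, Finset.mem_univ, and_true]
          exact ⟨(g, i, SignType.sign a), ⟨hg, hi⟩, rfl⟩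
        · have hsa : ((SignType.sign a : SignType) : ℝ) * a = |a| := sign_mul_self a
          have hs1 : |((SignType.sign a : SignType) : ℝ)| ≤ 1 := by
            rcases lt_trichotomy a 0 with h0 | h0 | h0 <;> simp [h0]
          set s : ℝ := ((SignType.sign a : SignType) : ℝ) with hs
          have hs2 : s ^ 2 ≤ 1 := by
            rw [← sq_abs]; exact pow_le_one₀ (abs_nonneg _) hs1
          have hw2 : ‖w i‖ ^ 2 ≤ 1 := pow_le_one₀ (norm_nonneg _) (hw i hi)
          have hsw : s ^ 2 * ‖w i‖ ^ 2 ≤ 1 := mul_le_one₀ hs2 (by positivity) hw2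
          have hx : ‖u - (g + (e * s) • w i)‖ ^ 2
              = ‖u - g‖ ^ 2 - 2 * (e * (s * a)) + e ^ 2 * (s ^ 2 * ‖w i‖ ^ 2) := by
            rw [← sub_sub, norm_sub_sq_real, inner_smul_right, real_inner_comm, ← ha,
              norm_smul, mul_pow, Real.norm_eq_abs, sq_abs]
            ring
          rw [hx, hsa]
          push_cast
          have h1 : e * e ≤ e * |a| := by gcongr
          have h2 : e ^ 2 * (s ^ 2 * ‖w i‖ ^ 2) ≤ e ^ 2 * 1 := by gcongr
          nlinarith

variable {E : Type*} [NormedAddCommGroup E] [InnerProductSpace ℝ E]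

/-! ### Comparing two candidate centers with the same code -/

/-- Two centers at almost the same distance from `x₀`, whose directions from `x₀` have almost the
same inner product with the direction of `x`, are almost equally far from `x`. The hypothesis `hx`
turns the additive error, of order `e * ‖c - x₀‖ * ‖x - c‖`, into a relative one. If `x = x₀` then
the normalized direction of `x` is `0`. -/
theorem abs_norm_sub_sq_sub_le {x₀ x c c' g : E} {e : ℝ} (he : 0 < e) (he' : e ≤ 1 / 60)
    (hc : 0 < ‖c - x₀‖) (hc' : 0 < ‖c' - x₀‖)
    (hg : |inner ℝ (‖x - x₀‖⁻¹ • (x - x₀)) (‖c - x₀‖⁻¹ • (c - x₀) - g)| ≤ e)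
    (hg' : |inner ℝ (‖x - x₀‖⁻¹ • (x - x₀)) (‖c' - x₀‖⁻¹ • (c' - x₀) - g)| ≤ e)
    (hr : |‖c' - x₀‖ - ‖c - x₀‖| ≤ e * ‖c - x₀‖) (hx : ‖c - x₀‖ ≤ ‖x - c‖) :
    |‖x - c'‖ ^ 2 - ‖x - c‖ ^ 2| ≤ 15 * e * ‖x - c‖ ^ 2 := by
  set v := x - x₀ with hv
  set u := c - x₀ with hu
  set u' := c' - x₀ with hu'
  have e1 : x - c = v - u := by rw [hv, hu]; abel
  have e2 : x - c' = v - u' := by rw [hv, hu']; abel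
  set w := ‖v‖⁻¹ • v with hw
  have hvw : v = ‖v‖ • w := by
    rcases eq_or_ne v 0 with h | h
    · rw [hw, h]; simp
    · rw [hw, smul_inv_smul₀ (norm_ne_zero_iff.2 h)]
  have hw1 : ‖w‖ ≤ 1 := by
    rw [hw, norm_smul, norm_inv, norm_norm]; exact inv_mul_le_one
  set z := ‖u‖⁻¹ • u with hz
  set z' := ‖u'‖⁻¹ • u' with hz'
  have huz : u = ‖u‖ • z := by rw [hz, smul_inv_smul₀ hc.ne']
  have huz' : u' = ‖u'‖ • z' := by rw [hz', smul_inv_smul₀ hc'.ne']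
  have hz1 : ‖z'‖ ≤ 1 := by
    rw [hz', norm_smul, norm_inv, norm_norm]; exact inv_mul_le_one
  set a := inner ℝ w z with ha
  set b := inner ℝ w z' with hb
  have hab : |b - a| ≤ 2 * e := by
    rw [inner_sub_right, abs_le] at hg hg'
    rw [abs_le]; constructor <;> linarith [hg.1, hg.2, hg'.1, hg'.2]
  have hb1 : |b| ≤ 1 := (abs_real_inner_le_norm _ _).trans (mul_le_one₀ hw1 (norm_nonneg _) hz1)
  have i1 : inner ℝ v u = ‖v‖ * (‖u‖ * a) := by
    conv_lhs => rw [hvw, huz]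
    rw [real_inner_smul_left, real_inner_smul_right]
  have i2 : inner ℝ v u' = ‖v‖ * (‖u'‖ * b) := by
    conv_lhs => rw [hvw, huz']
    rw [real_inner_smul_left, real_inner_smul_right]
  have hσ : ‖v‖ ≤ 2 * ‖x - c‖ := by
    rw [e1] at hx ⊢
    linarith [norm_le_norm_add_norm_sub' v u]
  rw [e1] at hx hσ ⊢
  rw [e2]
  rw [norm_sub_sq_real v u', i2]
  have hD : ‖v - u‖ ^ 2 = ‖v‖ ^ 2 - 2 * (‖v‖ * (‖u‖ * a)) + ‖u‖ ^ 2 := by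
    rw [norm_sub_sq_real, i1]
  set D := ‖v - u‖
  set r := ‖u‖
  set r' := ‖u'‖
  set σ := ‖v‖
  have h1 : |r' * b - r * a| ≤ 3 * e * r := by
    have : r' * b - r * a = (r' - r) * b + r * (b - a) := by ring
    rw [this]
    refine (abs_add_le _ _).trans ?_
    rw [abs_mul, abs_mul, abs_of_pos hc]
    have := mul_le_mul hr hb1 (abs_nonneg _) (by positivity)
    have := mul_le_mul_of_nonneg_left hab hc.le
    linarith
  have h2 : |r' ^ 2 - r ^ 2| ≤ 3 * e * r ^ 2 := by
    have : r' ^ 2 - r ^ 2 = (r' - r) * (r' + r) := by ring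
    rw [this, abs_mul, abs_of_pos (by positivity : 0 < r' + r)]
    have h3 : r' + r ≤ 3 * r := by
      have := (abs_le.1 hr).2
      nlinarith
    have := mul_le_mul hr h3 (by positivity) (by positivity)
    linarith
  have h4 : σ ^ 2 - 2 * (σ * (r' * b)) + r' ^ 2 - D ^ 2
      = (r' ^ 2 - r ^ 2) + (-(2 * σ)) * (r' * b - r * a) := by rw [hD]; ring
  rw [h4]
  have hσ0 : 0 ≤ σ := norm_nonneg _
  have hD0 : 0 ≤ D := norm_nonneg _
  refine (abs_add_le _ _).trans ?_
  rw [abs_mul, abs_neg, abs_of_nonneg (by positivity : 0 ≤ 2 * σ)]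
  have h5 : 2 * σ * |r' * b - r * a| ≤ 2 * (2 * D) * (3 * e * D) := by
    have : |r' * b - r * a| ≤ 3 * e * D := h1.trans (by gcongr)
    gcongr
  have h6 : 3 * e * r ^ 2 ≤ 3 * e * D ^ 2 := by gcongr
  linarith

/-- The union, over the scales `σ`, of the geometric progressions with ratio `1 + e` and `M + 1`
terms that start at `e * σ`. For large `M` the progression of `σ` covers the window
`[e * σ, σ / e]`. -/
noncomputable def scaleGrid (scales : Finset ℝ) (e : ℝ) (M : ℕ) : Finset ℝ :=
  (scales ×ˢ Finset.range (M + 1)).image fun p => p.1 * (e * (1 + e) ^ p.2)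

theorem card_scaleGrid_le (scales : Finset ℝ) (e : ℝ) (M : ℕ) :
    (scaleGrid scales e M).card ≤ scales.card * (M + 1) := by
  refine Finset.card_image_le.trans ?_
  rw [Finset.card_product, Finset.card_range]

/-- Two radii that lie in the same cell of the grid are nearly equal, or else every scale is
negligible against both of them or dominates both. The hypothesis `hM` says that the window of `σ`
reaches up to `σ / e`. -/
theorem scaleGrid_trichotomy {scales : Finset ℝ} {e : ℝ} {M : ℕ} (he : 0 < e)
    (hM : 1 ≤ e ^ 2 * (1 + e) ^ M) {r r' : ℝ}
    (h : ∀ γ ∈ scaleGrid scales e M, γ ≤ r ↔ γ ≤ r') {σ : ℝ} (hσ : σ ∈ scales) (hσ0 : 0 ≤ σ) :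
    |r' - r| ≤ e * r ∨ (σ ≤ e * r ∧ σ ≤ e * r') ∨ (r ≤ e * σ ∧ r' ≤ e * σ) := by
  have hmem : ∀ i ≤ M, (σ * (e * (1 + e) ^ i) ≤ r ↔ σ * (e * (1 + e) ^ i) ≤ r') := fun i hi =>
    h _ (Finset.mem_image.2 ⟨(σ, i), by simp [hσ]; omega, rfl⟩)
  by_cases h0 : σ * (e * (1 + e) ^ 0) ≤ r
  · by_cases hMr : σ * (e * (1 + e) ^ M) ≤ r
    · right; left
      have key : ∀ t : ℝ, σ * (e * (1 + e) ^ M) ≤ t → σ ≤ e * t := fun t ht => by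
        calc σ = σ * 1 := (mul_one σ).symm
          _ ≤ σ * (e ^ 2 * (1 + e) ^ M) := by gcongr
          _ = e * (σ * (e * (1 + e) ^ M)) := by ring
          _ ≤ e * t := by gcongr
      exact ⟨key _ hMr, key _ ((hmem M le_rfl).1 hMr)⟩
    · left
      -- the last grid point of the window of `σ` that is at most `r`
      obtain ⟨i, hi, hi1, hi2⟩ : ∃ i < M, σ * (e * (1 + e) ^ i) ≤ r ∧
          ¬ σ * (e * (1 + e) ^ (i + 1)) ≤ r := by
        by_contra hcon
        push Not at hcon
        have : ∀ i ≤ M, σ * (e * (1 + e) ^ i) ≤ r := by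
          intro i
          induction i with
          | zero => exact fun _ => h0
          | succ i ih => exact fun hi => hcon i (by omega) (ih (by omega))
        exact hMr (this M le_rfl)
      have hi1' := (hmem i hi.le).1 hi1
      have hi2' := fun hh => hi2 ((hmem (i + 1) hi).2 hh)
      rw [not_le] at hi2
      rw [pow_succ] at hi2 hi2'
      have hi3 := not_le.1 hi2'
      set q := σ * (e * (1 + e) ^ i) with hq
      have e1 : σ * (e * ((1 + e) ^ i * (1 + e))) = q * (1 + e) := by rw [hq]; ring
      rw [e1] at hi2 hi3
      rw [abs_le]
      constructor <;> nlinarith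
  · right; right
    have h0' : ¬ σ * (e * (1 + e) ^ 0) ≤ r' := fun hh => h0 ((hmem 0 (by omega)).2 hh)
    rw [pow_zero, mul_one, not_le, mul_comm] at h0 h0'
    exact ⟨h0.le, h0'.le⟩

/-- The center `p` can replace the center `c` for the clients in `A`: no squared distance grows by
more than a factor `1 + 15 * e` and an additive term of order `e * δ ^ 2`, and no distance that
reaches a threshold in `thr` falls below half of that threshold. -/
structure IsSubstitute (A : Finset E) (thr : Finset ℝ) (e δ : ℝ) (c p : E) : Prop where
  upper : ∀ x ∈ A, ‖x - p‖ ^ 2 ≤ (1 + 15 * e) * ‖x - c‖ ^ 2 + 2 * e * δ ^ 2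
  lower : ∀ x ∈ A, ∀ τ ∈ thr, τ ≤ ‖x - c‖ → τ / 2 ≤ ‖x - p‖

/-- Centers with the same nearest client `x₀`, radii in the same cell of the grid, and directions
near the same net point `g` are substitutes for each other, provided that the radius of the new one
is not larger by more than a factor `1 + e`. If the radii are not nearly equal, they lie in a gap
between scales: a client is then either so near `x₀` that its distance to a center is essentially
the radius, or so far that its distance to a center is essentially its distance to `x₀`; and a
threshold below the radius of `c` is also below that of `c'`. -/
theorem isSubstitute_of_same_code {A : Finset E} {thr scales : Finset ℝ} {e δ : ℝ} {M : ℕ}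
    (he : 0 < e) (he' : e ≤ 1 / 60) (hM : 1 ≤ e ^ 2 * (1 + e) ^ M) {x₀ c c' g : E}
    (hA : ∀ x ∈ A, ‖x - x₀‖ ∈ scales) (hthr : thr ⊆ scales) (hpos : ∀ τ ∈ thr, 0 < τ)
    (hc : 0 < ‖c - x₀‖) (hc' : 0 < ‖c' - x₀‖)
    (hx : ∀ x ∈ A, ‖c - x₀‖ ≤ ‖x - c‖) (hx' : ∀ x ∈ A, ‖c' - x₀‖ ≤ ‖x - c'‖)
    (hg : ∀ x ∈ A, |inner ℝ (‖x - x₀‖⁻¹ • (x - x₀)) (‖c - x₀‖⁻¹ • (c - x₀) - g)| ≤ e)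
    (hg' : ∀ x ∈ A, |inner ℝ (‖x - x₀‖⁻¹ • (x - x₀)) (‖c' - x₀‖⁻¹ • (c' - x₀) - g)| ≤ e)
    (hcell : ∀ γ ∈ scaleGrid scales e M, γ ≤ ‖c - x₀‖ ↔ γ ≤ ‖c' - x₀‖)
    (hmin : ‖c' - x₀‖ ≤ (1 + e) * ‖c - x₀‖) :
    IsSubstitute A thr e δ c c' := by
  have tri : ∀ x : E, ‖x - c'‖ ≤ ‖x - x₀‖ + ‖c' - x₀‖ := fun x => by
    rw [norm_sub_rev c']; exact norm_sub_le_norm_sub_add_norm_sub _ _ _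
  have tri2 : ∀ x : E, ‖x - x₀‖ ≤ ‖x - c‖ + ‖c - x₀‖ := fun x =>
    norm_sub_le_norm_sub_add_norm_sub _ _ _
  have tri3 : ∀ x : E, ‖x - x₀‖ ≤ ‖x - c'‖ + ‖c' - x₀‖ := fun x =>
    norm_sub_le_norm_sub_add_norm_sub _ _ _
  have tri4 : ∀ x : E, ‖x - c‖ ≤ ‖x - x₀‖ + ‖c - x₀‖ := fun x => by
    rw [norm_sub_rev c]; exact norm_sub_le_norm_sub_add_norm_sub _ _ _
  by_cases hclose : |‖c' - x₀‖ - ‖c - x₀‖| ≤ e * ‖c - x₀‖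
  · have key : ∀ x ∈ A, _ := fun x hxA =>
      abs_le.1 (abs_norm_sub_sq_sub_le he he' hc hc' (hg x hxA) (hg' x hxA) hclose (hx x hxA))
    refine ⟨fun x hxA => ?_, fun x hxA τ hτ hle => ?_⟩
    · have := (key x hxA).2
      have : 0 ≤ 2 * e * δ ^ 2 := by positivity
      linarith
    · have h1 := (key x hxA).1
      have h2 := hpos τ hτ
      refine le_of_sq_le_sq ?_ (norm_nonneg _)
      have h3 : τ ^ 2 ≤ ‖x - c‖ ^ 2 := by gcongr
      nlinarith [sq_nonneg ‖x - c‖]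
  · have cases : ∀ σ ∈ scales, 0 ≤ σ → (σ ≤ e * ‖c - x₀‖ ∧ σ ≤ e * ‖c' - x₀‖) ∨
        (‖c - x₀‖ ≤ e * σ ∧ ‖c' - x₀‖ ≤ e * σ) := fun σ hσ h0 =>
      (scaleGrid_trichotomy he hM hcell hσ h0).resolve_left hclose
    refine ⟨fun x hxA => ?_, fun x hxA τ hτ hle => ?_⟩
    · have h1 : ‖x - c'‖ ≤ (1 + 3 * e) * ‖x - c‖ := by
        have t1 := tri x
        have t2 := tri2 x
        have t3 := hx x hxA
        have t4 := norm_nonneg (x - c)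
        rcases cases _ (hA x hxA) (norm_nonneg _) with h | h
        · nlinarith [h.1, h.2]
        · have h5 : ‖x - x₀‖ * (1 - e) ≤ ‖x - c‖ := by linarith [h.1]
          have h6 : ‖x - c'‖ ≤ ‖x - x₀‖ * (1 + e) := by linarith [h.2]
          have h7 : (1 + e) ≤ (1 + 3 * e) * (1 - e) := by nlinarith
          have := norm_nonneg (x - x₀)
          calc ‖x - c'‖ ≤ ‖x - x₀‖ * (1 + e) := h6
            _ ≤ ‖x - x₀‖ * ((1 + 3 * e) * (1 - e)) := by gcongr
            _ = (1 + 3 * e) * (‖x - x₀‖ * (1 - e)) := by ring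
            _ ≤ _ := by gcongr
      have h2 : ‖x - c'‖ ^ 2 ≤ ((1 + 3 * e) * ‖x - c‖) ^ 2 := by gcongr
      have h3 : (1 + 3 * e) ^ 2 ≤ 1 + 15 * e := by nlinarith
      have h4 : 0 ≤ 2 * e * δ ^ 2 := by positivity
      have h5 : (1 + 3 * e) ^ 2 * ‖x - c‖ ^ 2 ≤ (1 + 15 * e) * ‖x - c‖ ^ 2 := by gcongr
      rw [mul_pow] at h2
      linarith
    · have h2 := hpos τ hτ
      rcases cases _ (hA x hxA) (norm_nonneg _) with h | h
      · rcases cases τ (hthr hτ) h2.le with h' | h'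
        · have := hx' x hxA
          nlinarith [h'.2]
        · exfalso
          have := tri4 x
          nlinarith [h.1, h'.1]
      · have := tri3 x
        have := tri4 x
        nlinarith [h.1, h.2, norm_nonneg (x - x₀)]

/-! ### The net of substitutes -/

/-- The infimum of `f` over `Q` is positive, hence approximated within the factor `1 + e`. -/
theorem exists_near_minimizer {X : Type*} (Q : X → Prop) (f : X → ℝ) {γ e : ℝ} (hγ : 0 < γ)
    (he : 0 < e) (hf : ∀ c, Q c → γ ≤ f c) (hne : ∃ c, Q c) :
    ∃ p, Q p ∧ ∀ c, Q c → f p ≤ (1 + e) * f c := by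
  obtain ⟨c₀, hc₀⟩ := hne
  have hbdd : BddBelow (f '' {c | Q c}) := ⟨γ, by rintro _ ⟨c, hc, rfl⟩; exact hf c hc⟩
  have hne : (f '' {c | Q c}).Nonempty := ⟨_, c₀, hc₀, rfl⟩
  have hm : γ ≤ sInf (f '' {c | Q c}) :=
    le_csInf hne (by rintro _ ⟨c, hc, rfl⟩; exact hf c hc)
  obtain ⟨_, ⟨p, hp, rfl⟩, hlt⟩ :=
    exists_lt_of_csInf_lt hne (show sInf (f '' {c | Q c}) < (1 + e) * sInf (f '' {c | Q c}) by
      nlinarith)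
  refine ⟨p, hp, fun c hc => hlt.le.trans ?_⟩
  have := csInf_le hbdd ⟨c, hc, rfl⟩
  gcongr

theorem sq_add_mul_le {a e δ : ℝ} (he : 0 < e) (he' : e ≤ 1) :
    (a + e * δ) ^ 2 ≤ (1 + e) * a ^ 2 + 2 * e * δ ^ 2 := by
  have h3 : 0 ≤ e * (a - δ) ^ 2 := by positivity
  have h5 : e * (e * δ ^ 2) ≤ 1 * (e * δ ^ 2) := by gcongr
  nlinarith

/-- A center that is much closer to the client `x₀` than every threshold is replaced by `x₀`. -/
theorem isSubstitute_of_near {V : Type*} [NormedAddCommGroup V] {A : Finset V}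
    {thr : Finset ℝ} {e δ : ℝ} (he : 0 < e) (he' : e ≤ 1 / 60) (hδ : 0 < δ)
    (hδthr : ∀ τ ∈ thr, δ ≤ τ) {x₀ c : V} (hc : ‖c - x₀‖ ≤ e * δ) :
    IsSubstitute A thr e δ c x₀ := by
  refine ⟨fun x _ => ?_, fun x _ τ hτ hle => ?_⟩
  · have h1 : ‖x - x₀‖ ≤ ‖x - c‖ + e * δ :=
      (norm_sub_le_norm_sub_add_norm_sub x c x₀).trans (by gcongr)
    have h2 : ‖x - x₀‖ ^ 2 ≤ (‖x - c‖ + e * δ) ^ 2 := by gcongr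
    have h3 := sq_add_mul_le (a := ‖x - c‖) (δ := δ) he (by linarith)
    have h4 : 0 ≤ e * ‖x - c‖ ^ 2 := by positivity
    linarith
  · have h1 : ‖x - c‖ ≤ ‖x - x₀‖ + ‖c - x₀‖ := by
      rw [norm_sub_rev c]; exact norm_sub_le_norm_sub_add_norm_sub _ _ _
    have := hδthr τ hτ
    nlinarith

/-- A code consists of the nearest client `x₀`, the largest grid point `γ` below the radius, and a
point `g` of the greedy net near the direction; the net holds one center of almost minimal radius
for each code that occurs, together with `A` for the centers that almost coincide with a client. -/
theorem exists_substitute_net {A : Finset E} (hA : A.Nonempty) {thr : Finset ℝ} {e δ : ℝ}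
    {M N : ℕ} (he : 0 < e) (he' : e ≤ 1 / 60) (hM : 1 ≤ e ^ 2 * (1 + e) ^ M)
    (hN : 1 < N * e ^ 2) (hδ : 0 < δ) (hδthr : ∀ τ ∈ thr, δ ≤ τ) :
    ∃ F : Finset E,
      F.card ≤ A.card + A.card * ((A.card + thr.card + 1) * (M + 1) * (3 * A.card) ^ N) ∧
      ∀ c : E, ∃ p ∈ F, IsSubstitute A thr e δ c p := by
  classical
  have hnet : ∀ x₀ : E, ∃ S : Finset E, S.card ≤ (3 * A.card) ^ N ∧
      ∀ u : E, ‖u‖ ≤ 1 → ∃ g ∈ S, ∀ x ∈ A,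
        |inner ℝ (‖x - x₀‖⁻¹ • (x - x₀)) (u - g)| ≤ e := by
    intro x₀
    obtain ⟨S, hS, h⟩ := exists_greedy_net hA (fun x => ‖x - x₀‖⁻¹ • (x - x₀))
      (fun x _ => by rw [norm_smul, norm_inv, norm_norm]; exact inv_mul_le_one) he N
    refine ⟨S, hS, fun u hu => ?_⟩
    obtain ⟨g, hg, hgood | hbad⟩ := h u hu
    · exact ⟨g, hg, hgood⟩
    · have := sq_nonneg ‖u - g‖
      linarith
  choose S hS hSnet using hnet
  let scales : E → Finset ℝ := fun x₀ => insert δ (A.image (fun x => ‖x - x₀‖) ∪ thr)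
  let Γ : E → Finset ℝ := fun x₀ => scaleGrid (scales x₀) e M
  let Q : E → ℝ → E → E → Prop := fun x₀ γ g c =>
    (∀ x ∈ A, ‖c - x₀‖ ≤ ‖x - c‖) ∧ IsGreatest {γ' | γ' ∈ Γ x₀ ∧ γ' ≤ ‖c - x₀‖} γ ∧ 0 < γ ∧
      ∀ x ∈ A, |inner ℝ (‖x - x₀‖⁻¹ • (x - x₀)) (‖c - x₀‖⁻¹ • (c - x₀) - g)| ≤ e
  have hrep : ∀ x₀ γ g, ∃ p, ∀ c, Q x₀ γ g c →
      Q x₀ γ g p ∧ ‖p - x₀‖ ≤ (1 + e) * ‖c - x₀‖ := by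
    intro x₀ γ g
    by_cases hne : ∃ c, Q x₀ γ g c
    · have hγ : 0 < γ := by obtain ⟨c, hc⟩ := hne; exact hc.2.2.1
      obtain ⟨p, hp, hmin⟩ := exists_near_minimizer (Q x₀ γ g) (fun c => ‖c - x₀‖) hγ he
        (fun c hc => hc.2.1.1.2) hne
      exact ⟨p, fun c hc => ⟨hp, hmin c hc⟩⟩
    · exact ⟨x₀, fun c hc => (hne ⟨c, hc⟩).elim⟩
  choose rep hrep using hrep
  refine ⟨A ∪ A.biUnion fun x₀ => (Γ x₀ ×ˢ S x₀).image fun q => rep x₀ q.1 q.2, ?_, ?_⟩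
  · refine (Finset.card_union_le _ _).trans (Nat.add_le_add_left ?_ _)
    refine Finset.card_biUnion_le_card_mul _ _ _ fun x₀ _ => ?_
    refine Finset.card_image_le.trans ?_
    rw [Finset.card_product]
    refine Nat.mul_le_mul ((card_scaleGrid_le _ _ _).trans (Nat.mul_le_mul_right _ ?_)) (hS x₀)
    refine (Finset.card_insert_le _ _).trans (Nat.add_le_add_right ?_ _)
    exact (Finset.card_union_le _ _).trans (Nat.add_le_add_right Finset.card_image_le _)
  · intro c
    obtain ⟨x₀, hx₀, hnear⟩ := A.exists_min_image (fun x => ‖x - c‖) hA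
    by_cases hsmall : ‖c - x₀‖ ≤ e * δ
    · exact ⟨x₀, Finset.mem_union_left _ hx₀, isSubstitute_of_near he he' hδ hδthr hsmall⟩
    · rw [not_le] at hsmall
      have hcpos : 0 < ‖c - x₀‖ := lt_trans (by positivity) hsmall
      have hstart : δ * (e * (1 + e) ^ 0) ∈ (Γ x₀).filter (· ≤ ‖c - x₀‖) := by
        refine Finset.mem_filter.2 ⟨Finset.mem_image.2 ⟨(δ, 0), by simp [scales], rfl⟩, ?_⟩
        rw [pow_zero, mul_one, mul_comm]; exact hsmall.le
      obtain ⟨γ, hγmem, hγmax⟩ := Finset.exists_max_image _ id ⟨_, hstart⟩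
      have hstart_pos : 0 < δ * (e * (1 + e) ^ 0) := by positivity
      have hγpos : 0 < γ := hstart_pos.trans_le (hγmax _ hstart)
      obtain ⟨g, hgS, hg⟩ := hSnet x₀ (‖c - x₀‖⁻¹ • (c - x₀))
        (by rw [norm_smul, norm_inv, norm_norm]; exact inv_mul_le_one)
      rw [Finset.mem_filter] at hγmem
      have hQ : Q x₀ γ g c := by
        refine ⟨fun x hx => ?_, ⟨hγmem, fun γ' hγ' => ?_⟩, hγpos, hg⟩
        · rw [norm_sub_rev c]; exact hnear x hx
        · exact hγmax γ' (Finset.mem_filter.2 hγ')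
      obtain ⟨hQ', hmin⟩ := hrep x₀ γ g c hQ
      refine ⟨rep x₀ γ g, Finset.mem_union_right _ (Finset.mem_biUnion.2 ⟨x₀, hx₀,
        Finset.mem_image.2 ⟨(γ, g), Finset.mem_product.2 ⟨hγmem.1, hgS⟩, rfl⟩⟩), ?_⟩
      refine isSubstitute_of_same_code (scales := scales x₀) (x₀ := x₀) (g := g) (M := M) he he' hM
        (fun x hx => ?_) (fun τ hτ => ?_) (fun τ hτ => hδ.trans_le (hδthr τ hτ)) hcpos
        (hγpos.trans_le hQ'.2.1.1.2) hQ.1 hQ'.1 hQ.2.2.2 hQ'.2.2.2 (fun γ' hγ' => ?_) hmin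
      · simp only [scales, Finset.mem_insert, Finset.mem_union, Finset.mem_image]
        exact Or.inr (Or.inl ⟨x, hx, rfl⟩)
      · simp only [scales, Finset.mem_insert, Finset.mem_union]
        exact Or.inr (Or.inr hτ)
      · exact ⟨fun h => (hQ.2.1.2 ⟨hγ', h⟩).trans hQ'.2.1.1.2,
          fun h => (hQ'.2.1.2 ⟨hγ', h⟩).trans hQ.2.1.1.2⟩

/-! ### Distinct centers by small translations -/

theorem exists_pos_separation {V : Type*} [NormedAddCommGroup V] (F : Finset V) :
    ∃ ρ : ℝ, 0 < ρ ∧ ∀ p ∈ F, ∀ q ∈ F, ‖p - q‖ < ρ → p = q := by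
  classical
  by_cases h : F.offDiag.Nonempty
  · obtain ⟨⟨a, b⟩, hab, hmin⟩ := F.offDiag.exists_min_image (fun q => ‖q.1 - q.2‖) h
    rw [Finset.mem_offDiag] at hab
    refine ⟨‖a - b‖, norm_pos_iff.2 (sub_ne_zero.2 hab.2.2), fun p hp q hq hlt => ?_⟩
    by_contra hne
    exact absurd (hmin (p, q) (Finset.mem_offDiag.2 ⟨hp, hq, hne⟩)) (not_le.2 hlt)
  · refine ⟨1, one_pos, fun p hp q hq _ => ?_⟩
    by_contra hne
    exact h ⟨(p, q), Finset.mem_offDiag.2 ⟨hp, hq, hne⟩⟩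

/-- Each point of `F` is accompanied by `n` translates along a fixed direction, by at most half of
the least distance in `F`; giving the `i`-th center its `i`-th translate makes the centers
distinct. -/
theorem exists_injective_perturbation [Nontrivial E] (F : Finset E) {n : ℕ} (hn : 0 < n)
    {h : ℝ} (hh : 0 < h) :
    ∃ F' : Finset E, F'.card ≤ F.card * n ∧ F ⊆ F' ∧
      ∀ (k : ℕ) (p : Fin k → E), k ≤ n → (∀ i, p i ∈ F) →
        ∃ s : Fin k → E, Function.Injective s ∧ (∀ i, s i ∈ F') ∧ ∀ i, ‖s i - p i‖ ≤ h := by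
  classical
  obtain ⟨ρ, hρ, hsep⟩ := exists_pos_separation F
  obtain ⟨w, hw⟩ := exists_norm_eq E zero_le_one
  set η := min h (ρ / 2) / n with hη
  have hn' : (0 : ℝ) < n := by exact_mod_cast hn
  have hηpos : 0 < η := by positivity
  have hηn : n * η = min h (ρ / 2) := by rw [hη]; field_simp
  refine ⟨(F ×ˢ Finset.range n).image fun q => q.1 + ((q.2 : ℝ) * η) • w, ?_, ?_, ?_⟩
  · refine Finset.card_image_le.trans ?_
    rw [Finset.card_product, Finset.card_range]
  · intro p hp
    exact Finset.mem_image.2 ⟨(p, 0), by simp [hp, hn], by simp⟩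
  · intro k p hk hp
    refine ⟨fun i => p i + (((i : ℕ) : ℝ) * η) • w, fun i j hij => ?_, fun i => ?_, fun i => ?_⟩
    · have hij' : p i - p j = ((((j : ℕ) : ℝ) - ((i : ℕ) : ℝ)) * η) • w := by
        rw [sub_mul, sub_smul]
        have : p i + (((i : ℕ) : ℝ) * η) • w = p j + (((j : ℕ) : ℝ) * η) • w := hij
        rw [eq_sub_iff_add_eq, sub_add_eq_add_sub, this, add_sub_cancel_left]
      have hnorm : ‖p i - p j‖ = |((j : ℕ) : ℝ) - ((i : ℕ) : ℝ)| * η := by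
        rw [hij', norm_smul, hw, mul_one, norm_mul, Real.norm_eq_abs, Real.norm_eq_abs,
          abs_of_pos hηpos]
      have hi : ((i : ℕ) : ℝ) ≤ n := by exact_mod_cast i.2.le.trans hk
      have hj : ((j : ℕ) : ℝ) ≤ n := by exact_mod_cast j.2.le.trans hk
      have hji : |((j : ℕ) : ℝ) - ((i : ℕ) : ℝ)| ≤ n := by
        rw [abs_le]
        constructor <;>
          linarith [Nat.cast_nonneg (α := ℝ) (i : ℕ), Nat.cast_nonneg (α := ℝ) (j : ℕ)]
      have hlt : ‖p i - p j‖ < ρ := by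
        rw [hnorm]
        calc |((j : ℕ) : ℝ) - ((i : ℕ) : ℝ)| * η ≤ n * η := by gcongr
          _ ≤ ρ / 2 := hηn.trans_le (min_le_right _ _)
          _ < ρ := by linarith
      have heq := hsep _ (hp i) _ (hp j) hlt
      rw [heq, sub_self, norm_zero] at hnorm
      have h0 := (mul_eq_zero.1 hnorm.symm).resolve_right hηpos.ne'
      rw [abs_eq_zero, sub_eq_zero] at h0
      exact Fin.ext (by exact_mod_cast h0.symm)
    · exact Finset.mem_image.2 ⟨(p i, i), by simp [hp i, i.2.trans_le hk], rfl⟩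
    · have hi : ((i : ℕ) : ℝ) ≤ n := by exact_mod_cast i.2.le.trans hk
      rw [add_sub_cancel_left, norm_smul, hw, mul_one, Real.norm_eq_abs,
        abs_of_nonneg (by positivity)]
      calc ((i : ℕ) : ℝ) * η ≤ n * η := by gcongr
        _ ≤ h := hηn.trans_le (min_le_left _ _)

/-! ### Costs -/

theorem IsClustering.sum_eq {X : Type*} {A : Finset X} {k : ℕ} {C : Fin k → Finset X}
    (h : IsClustering A C) (f : X → ℝ) : ∑ i, ∑ x ∈ C i, f x = ∑ x ∈ A, f x := by
  classical
  have hA : A = Finset.univ.biUnion C := by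
    ext x; simp [h.mem_iff x]
  rw [hA, Finset.sum_biUnion fun i _ j _ hij => h.disjoint i j hij]

theorem IsClustering.subset {X : Type*} {A : Finset X} {k : ℕ} {C : Fin k → Finset X}
    (h : IsClustering A C) (i : Fin k) : C i ⊆ A := fun x hx => (h.mem_iff x).2 ⟨i, hx⟩

theorem IsClustering.exists_representatives {X : Type*} {A : Finset X} {k : ℕ}
    {C : Fin k → Finset X} (h : IsClustering A C) :
    ∃ a : Fin k → X, Function.Injective a ∧ ∀ i, a i ∈ C i := by
  choose a ha using h.nonempty
  refine ⟨a, fun i j hij => ?_, ha⟩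
  by_contra hne
  exact Finset.disjoint_left.1 (h.disjoint i j hne) (ha i) (hij ▸ ha j)

theorem mem_centerSet {X : Type*} {k : ℕ} (s : Fin k → X) (i : Fin k) : s i ∈ centerSet s := by
  simp [centerSet]

theorem card_centerSet_le {X : Type*} {k : ℕ} (s : Fin k → X) : (centerSet s).card ≤ k := by
  classical
  have : centerSet s = Finset.univ.image s := by ext; simp [centerSet]
  rw [this]
  exact Finset.card_image_le.trans (by simp)

variable {d : ℕ}

theorem solutionCost_nonneg (A T : Finset (EuclideanSpace ℝ (Fin d))) :
    0 ≤ solutionCost sqCost A T :=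
  Finset.sum_nonneg fun _ _ => Real.iInf_nonneg fun _ => sq_nonneg _

theorem iInf_sqCost_le {T : Finset (EuclideanSpace ℝ (Fin d))} {c : EuclideanSpace ℝ (Fin d)}
    (hc : c ∈ T) (x : EuclideanSpace ℝ (Fin d)) : ⨅ c : T, sqCost x c ≤ ‖x - c‖ ^ 2 :=
  ciInf_le (f := fun c : T => sqCost x c) (Set.finite_range _).bddBelow ⟨c, hc⟩

theorem exists_iInf_sqCost_eq {T : Finset (EuclideanSpace ℝ (Fin d))} (hT : T.Nonempty)
    (x : EuclideanSpace ℝ (Fin d)) : ∃ c ∈ T, ⨅ c : T, sqCost x c = ‖x - c‖ ^ 2 := by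
  have : Nonempty T := hT.coe_sort
  obtain ⟨c, hc⟩ := exists_eq_ciInf_of_finite (f := fun c : T => sqCost x c)
  exact ⟨c, c.2, hc.symm⟩

theorem iInf_sqCost_le_solutionCost {A T : Finset (EuclideanSpace ℝ (Fin d))}
    {x : EuclideanSpace ℝ (Fin d)} (hx : x ∈ A) :
    ⨅ c : T, sqCost x c ≤ solutionCost sqCost A T := by
  have h : ∀ z ∈ A, 0 ≤ ⨅ c : T, sqCost z c := fun z _ =>
    Real.iInf_nonneg fun c => sq_nonneg ‖z - c‖
  exact Finset.single_le_sum h hx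

theorem solutionCost_le_of_substitutes {A T T' : Finset (EuclideanSpace ℝ (Fin d))}
    (hT : T.Nonempty) {a b : ℝ}
    (h : ∀ c ∈ T, ∃ p ∈ T', ∀ x ∈ A, ‖x - p‖ ^ 2 ≤ a * ‖x - c‖ ^ 2 + b) :
    solutionCost sqCost A T' ≤ a * solutionCost sqCost A T + A.card * b := by
  have hsum : a * solutionCost sqCost A T + A.card * b
      = ∑ x ∈ A, (a * (⨅ c : T, sqCost x c) + b) := by
    rw [Finset.sum_add_distrib, ← Finset.mul_sum, Finset.sum_const, nsmul_eq_mul, solutionCost]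
  rw [hsum]
  refine Finset.sum_le_sum fun x hx => ?_
  obtain ⟨c, hc, heq⟩ := exists_iInf_sqCost_eq hT x
  obtain ⟨p, hp, hle⟩ := h c hc
  rw [heq]
  exact (iInf_sqCost_le hp x).trans (hle x hx)

theorem opt_le_solutionCost {A T : Finset (EuclideanSpace ℝ (Fin d))}
    {F : Set (EuclideanSpace ℝ (Fin d))} {k : ℕ} (hT : T.Nonempty) (hTF : (T : Set _) ⊆ F)
    (hk : T.card ≤ k) : opt sqCost A F k ≤ solutionCost sqCost A T :=
  csInf_le ⟨0, by rintro _ ⟨T, -, -, -, rfl⟩; exact solutionCost_nonneg A T⟩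
    ⟨T, hT, hTF, hk, rfl⟩

theorem exists_solutionCost_lt {A : Finset (EuclideanSpace ℝ (Fin d))} {k : ℕ} (hk : 0 < k)
    {v : ℝ} (hv : opt sqCost A Set.univ k < v) :
    ∃ T : Finset (EuclideanSpace ℝ (Fin d)), T.Nonempty ∧ T.card ≤ k ∧
      solutionCost sqCost A T < v := by
  rw [opt] at hv
  have hne : {v : ℝ | ∃ T : Finset (EuclideanSpace ℝ (Fin d)), T.Nonempty ∧
      (T : Set (EuclideanSpace ℝ (Fin d))) ⊆ Set.univ ∧ T.card ≤ k ∧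
      v = solutionCost sqCost A T}.Nonempty :=
    ⟨_, {0}, by simp, by simp, by rw [Finset.card_singleton]; exact hk, rfl⟩
  obtain ⟨_, ⟨T, hT, -, hTk, rfl⟩, hlt⟩ := exists_lt_of_csInf_lt hne hv
  exact ⟨T, hT, hTk, hlt⟩

theorem solutionCost_centerSet_le {A : Finset (EuclideanSpace ℝ (Fin d))} {k : ℕ}
    {C : Fin k → Finset (EuclideanSpace ℝ (Fin d))} (h : IsClustering A C)
    (s : Fin k → EuclideanSpace ℝ (Fin d)) :
    solutionCost sqCost A (centerSet s) ≤ clusteringCost sqCost C s := by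
  rw [solutionCost, ← h.sum_eq]
  exact Finset.sum_le_sum fun i _ => Finset.sum_le_sum fun x _ =>
    iInf_sqCost_le (mem_centerSet s i) x

theorem clusteringCost_le_of_substitutes {A : Finset (EuclideanSpace ℝ (Fin d))} {k : ℕ}
    {C : Fin k → Finset (EuclideanSpace ℝ (Fin d))} (hC : IsClustering A C)
    {s s' : Fin k → EuclideanSpace ℝ (Fin d)} {a b : ℝ}
    (h : ∀ i, ∀ x ∈ A, ‖x - s' i‖ ^ 2 ≤ a * ‖x - s i‖ ^ 2 + b) :
    clusteringCost sqCost C s' ≤ a * clusteringCost sqCost C s + A.card * b := by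
  have hsum : a * clusteringCost sqCost C s + A.card * b
      = ∑ i, ∑ x ∈ C i, (a * ‖x - s i‖ ^ 2 + b) := by
    have hb : (A.card : ℝ) * b = ∑ i, ∑ x ∈ C i, b := by
      rw [hC.sum_eq, Finset.sum_const, nsmul_eq_mul]
    rw [hb, clusteringCost, Finset.mul_sum, ← Finset.sum_add_distrib]
    refine Finset.sum_congr rfl fun i _ => ?_
    rw [Finset.sum_add_distrib, ← Finset.mul_sum]
    rfl
  rw [hsum]
  exact Finset.sum_le_sum fun i _ => Finset.sum_le_sum fun x hx => h i x (hC.subset i hx)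

/-- With fewer centers than clients, two clients at distance at least `ρ` share a center, so no
solution costs less than `(ρ / 2) ^ 2`. -/
theorem opt_pos {A : Finset (EuclideanSpace ℝ (Fin d))} {k : ℕ} (hk : 0 < k) (hkA : k < A.card) :
    0 < opt sqCost A Set.univ k := by
  classical
  obtain ⟨ρ, hρ, hsep⟩ := exists_pos_separation A
  refine (by positivity : 0 < (ρ / 2) ^ 2).trans_le (le_csInf ?_ ?_)
  · exact ⟨_, {0}, by simp, by simp, by rw [Finset.card_singleton]; exact hk, rfl⟩
  · rintro _ ⟨T, hT, -, hTk, rfl⟩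
    choose f hfT hf using exists_iInf_sqCost_eq hT
    obtain ⟨x, hx, y, hy, hxy, hfxy⟩ := Finset.exists_ne_map_eq_of_card_lt_of_maps_to
      (hTk.trans_lt hkA) (fun x _ => hfT x)
    have hle : ρ ≤ ‖x - y‖ := not_lt.1 fun hlt => hxy (hsep x hx y hy hlt)
    have single : ∀ z ∈ A, ρ / 2 ≤ ‖z - f z‖ → (ρ / 2) ^ 2 ≤ solutionCost sqCost A T :=
      fun z hz hzρ => by
        have h1 : (ρ / 2) ^ 2 ≤ ‖z - f z‖ ^ 2 := by gcongr
        exact h1.trans ((hf z).ge.trans (iInf_sqCost_le_solutionCost hz))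
    have htri : ‖x - y‖ ≤ ‖x - f x‖ + ‖y - f y‖ := by
      rw [norm_sub_rev y, ← hfxy]; exact norm_sub_le_norm_sub_add_norm_sub _ _ _
    rcases le_or_gt (ρ / 2) ‖x - f x‖ with hcase | hcase
    · exact single x hx hcase
    · exact single y hy (by linarith)

/-! ### As many clusters as clients -/

/-- With `|A|` clusters every cluster is a singleton, and its element serves as its center. All
costs and the optimum over `A` are then `0`, which makes stability trivial. -/
theorem exists_singleton_centers {A : Finset (EuclideanSpace ℝ (Fin d))} {β c : ℝ} {k : ℕ}
    (hk : A.card = k) (hβ : 0 < β) (hc : 0 < c)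
    {C : Fin k → Finset (EuclideanSpace ℝ (Fin d))} (hC : IsClustering A C) :
    ∃ s : Fin k → EuclideanSpace ℝ (Fin d),
      IsDistributionStable sqCost A (A : Set _) k (c * β) C s ∧
        clusteringCost sqCost C s = 0 := by
  obtain ⟨a, hinj, ha⟩ := hC.exists_representatives
  have haA : ∀ i, a i ∈ A := fun i => hC.subset i (ha i)
  have himg : Finset.univ.map ⟨a, hinj⟩ = A :=
    Finset.eq_of_subset_of_card_le (fun x hx => by
      obtain ⟨i, -, rfl⟩ := Finset.mem_map.1 hx; exact haA i) (by simp [hk])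
  have hsing : ∀ i, ∀ x ∈ C i, x = a i := by
    intro i x hx
    have hxA := hC.subset i hx
    rw [← himg] at hxA
    obtain ⟨j, -, rfl⟩ := Finset.mem_map.1 hxA
    by_contra hne
    exact Finset.disjoint_left.1 (hC.disjoint i j fun h => hne (h ▸ rfl)) hx (ha j)
  have hcost : clusteringCost sqCost C a = 0 :=
    Finset.sum_eq_zero fun i _ => Finset.sum_eq_zero fun x hx => by
      rw [hsing i x hx]; simp [sqCost]
  refine ⟨a, ⟨hC, haA, hinj, fun i j _ x _ => ?_⟩, hcost⟩
  have hopt : opt sqCost A (A : Set _) k ≤ 0 := by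
    refine (opt_le_solutionCost (T := centerSet a) ⟨_, mem_centerSet a i⟩ (fun x hx => ?_)
      (card_centerSet_le a)).trans ((solutionCost_centerSet_le hC a).trans hcost.le)
    have : x ∈ Set.range a := by simpa [centerSet] using hx
    obtain ⟨l, rfl⟩ := this
    exact haA l
  exact (mul_nonpos_of_nonneg_of_nonpos (by positivity)
    (div_nonpos_of_nonpos_of_nonneg hopt (Nat.cast_nonneg _))).trans (sq_nonneg _)

/-! ### Fewer clusters than clients -/

/-- The thresholds are the distances `√(β * OPT / m)` that stability with a cluster of size `m`
prescribes. The slack `δ` is at most `√(OPT / |A|)`, so that the additive errors sum to `O(e *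
OPT)`, and at most every threshold. Stability loses a factor `9` from substitution and translation
and a factor `4` because the optimum over `F` may be larger than the optimum over all centers. -/
theorem exists_stable_net {A : Finset (EuclideanSpace ℝ (Fin d))} {β e : ℝ} {k M N : ℕ}
    (hβ : 0 < β) (he : 0 < e) (he' : e ≤ 1 / 60) (hM : 1 ≤ e ^ 2 * (1 + e) ^ M)
    (hN : 1 < N * e ^ 2) (hk : 0 < k) (hkA : k < A.card) :
    ∃ F : Finset (EuclideanSpace ℝ (Fin d)),
      F.card ≤ (A.card + A.card * ((A.card + A.card + 1) * (M + 1) * (3 * A.card) ^ N)) * A.card ∧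
      ∀ (C : Fin k → Finset (EuclideanSpace ℝ (Fin d))) (s : Fin k → EuclideanSpace ℝ (Fin d)),
        IsDistributionStable sqCost A Set.univ k β C s →
        ∃ s' : Fin k → EuclideanSpace ℝ (Fin d),
          IsDistributionStable sqCost A (F : Set _) k (1 / 36 * β) C s' ∧
          clusteringCost sqCost C s' ≤ (1 + 22 * e) * clusteringCost sqCost C s ∧
          solutionCost sqCost A (centerSet s') ≤
            (1 + 22 * e) * solutionCost sqCost A (centerSet s) := by
  classical
  have hopt := opt_pos hk hkA
  set O := opt sqCost A Set.univ k with hO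
  have hn : 0 < A.card := by omega
  have hn' : (0 : ℝ) < A.card := by exact_mod_cast hn
  have hA : A.Nonempty := Finset.card_pos.1 hn
  have : Nontrivial (EuclideanSpace ℝ (Fin d)) := by
    obtain ⟨x, -, y, -, hxy⟩ := Finset.one_lt_card.1 (show 1 < A.card by omega)
    exact ⟨x, y, hxy⟩
  let thr : Finset ℝ := (Finset.Icc 1 A.card).image fun m : ℕ => √(β * (O / m))
  have hthr : thr.card ≤ A.card := Finset.card_image_le.trans (by simp)
  set δ : ℝ := min √(O / A.card) √(β * (O / A.card)) with hδdef
  have hδ : 0 < δ := by positivity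
  have hδthr : ∀ τ ∈ thr, δ ≤ τ := by
    intro τ hτ
    obtain ⟨m, hm, rfl⟩ := Finset.mem_image.1 hτ
    rw [Finset.mem_Icc] at hm
    have hm0 : (0 : ℝ) < m := by exact_mod_cast hm.1
    have hmn : (m : ℝ) ≤ A.card := by exact_mod_cast hm.2
    exact (min_le_right _ _).trans (Real.sqrt_le_sqrt (by gcongr))
  have hnδ : A.card * δ ^ 2 ≤ O := by
    have h1 : δ ^ 2 ≤ O / A.card := by
      rw [← Real.sq_sqrt (by positivity : 0 ≤ O / A.card)]
      exact pow_le_pow_left₀ hδ.le (min_le_left _ _) 2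
    rwa [le_div_iff₀ hn', mul_comm] at h1
  obtain ⟨F₀, hF₀, hsub⟩ := exists_substitute_net hA he he' hM hN hδ hδthr
  obtain ⟨F, hF, hFF, hpert⟩ := exists_injective_perturbation F₀ hn (mul_pos he hδ)
  choose p hpF hp using hsub
  refine ⟨F, hF.trans (Nat.mul_le_mul_right _ (hF₀.trans ?_)), ?_⟩
  · gcongr
  -- a near-optimal solution with arbitrary centers moves into the net
  have hoptF : opt sqCost A (F : Set _) k ≤ 4 * O := by
    obtain ⟨T, hT, hTk, hlt⟩ := exists_solutionCost_lt hk (show O < 2 * O by linarith)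
    have h1 := opt_le_solutionCost (A := A) (T := T.image p) (F := (F : Set _)) (k := k)
      (hT.image p) (fun x hx => by
        obtain ⟨c, -, rfl⟩ := Finset.mem_image.1 (Finset.mem_coe.1 hx)
        exact hFF (hpF c)) (Finset.card_image_le.trans hTk)
    have h2 := solutionCost_le_of_substitutes (A := A) (T' := T.image p) hT
      (fun c hc => ⟨p c, Finset.mem_image_of_mem p hc, (hp c).upper⟩)
    have h3 := solutionCost_nonneg A T
    nlinarith
  intro C s hs
  have hC := hs.isClustering
  obtain ⟨s', hinj, hs'F, hs'p⟩ := hpert k (fun i => p (s i)) hkA.le (fun i => hpF _)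
  have hup : ∀ i, ∀ x ∈ A, ‖x - s' i‖ ^ 2 ≤ (1 + 17 * e) * ‖x - s i‖ ^ 2 + 5 * e * δ ^ 2 := by
    intro i x hx
    have h1 : ‖x - s' i‖ ≤ ‖x - p (s i)‖ + e * δ := by
      refine (norm_sub_le_norm_sub_add_norm_sub x (p (s i)) (s' i)).trans ?_
      rw [norm_sub_rev (p (s i))]
      gcongr
      exact hs'p i
    have h2 : ‖x - s' i‖ ^ 2 ≤ (‖x - p (s i)‖ + e * δ) ^ 2 := by gcongr
    have h3 := sq_add_mul_le (a := ‖x - p (s i)‖) (δ := δ) he (by linarith)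
    have h4 := mul_le_mul_of_nonneg_left ((hp (s i)).upper x hx) (by linarith : 0 ≤ 1 + e)
    have h5 : (1 + e) * (1 + 15 * e) * ‖x - s i‖ ^ 2 ≤ (1 + 17 * e) * ‖x - s i‖ ^ 2 := by
      gcongr; nlinarith
    have h6 : ((1 + e) * (2 * e) + 2 * e) * δ ^ 2 ≤ 5 * e * δ ^ 2 := by
      gcongr; nlinarith
    linarith
  have hsC : O ≤ solutionCost sqCost A (centerSet s) := by
    exact opt_le_solutionCost ⟨_, mem_centerSet s ⟨0, hk⟩⟩ (Set.subset_univ _)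
      (card_centerSet_le s)
  have hslack : A.card * (5 * e * δ ^ 2) ≤ 5 * e * O := by
    have := mul_le_mul_of_nonneg_left hnδ (by positivity : 0 ≤ 5 * e)
    linarith
  refine ⟨s', ⟨hC, hs'F, hinj, fun i j hij x hx => ?_⟩, ?_, ?_⟩
  · have hxA := hC.subset i hx
    have hm : (C j).card ∈ Finset.Icc 1 A.card := Finset.mem_Icc.2
      ⟨Finset.card_pos.2 (hC.nonempty j), Finset.card_le_card (hC.subset j)⟩
    have hm0 : (0 : ℝ) < (C j).card := by exact_mod_cast (Finset.mem_Icc.1 hm).1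
    have hτ : √(β * (O / (C j).card)) ∈ thr := Finset.mem_image.2 ⟨_, hm, rfl⟩
    have hsq : √(β * (O / (C j).card)) ^ 2 = β * (O / (C j).card) :=
      Real.sq_sqrt (by positivity)
    have hst := hs.stable i j hij x hx
    have hle : √(β * (O / (C j).card)) ≤ ‖x - s j‖ := Real.sqrt_le_iff.2 ⟨norm_nonneg _, hst⟩
    have hlow := (hp (s j)).lower x hxA _ hτ hle
    have hδτ := hδthr _ hτ
    set τ := √(β * (O / (C j).card))
    have h1 : ‖x - p (s j)‖ ≤ ‖x - s' j‖ + e * δ :=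
      (norm_sub_le_norm_sub_add_norm_sub x (s' j) (p (s j))).trans (by gcongr; exact hs'p j)
    have h2 : τ / 3 ≤ ‖x - s' j‖ := by nlinarith
    have h3 : (τ / 3) ^ 2 ≤ ‖x - s' j‖ ^ 2 := by gcongr
    calc 1 / 36 * β * (opt sqCost A (F : Set _) k / (C j).card)
        ≤ 1 / 36 * β * (4 * O / (C j).card) := by gcongr
      _ = (τ / 3) ^ 2 := by rw [div_pow, hsq]; ring
      _ ≤ _ := h3
  · have h1 := clusteringCost_le_of_substitutes hC hup
    have h2 := hsC.trans (solutionCost_centerSet_le hC s)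
    have := mul_le_mul_of_nonneg_left h2 (by positivity : 0 ≤ 5 * e)
    linarith
  · have h1 := solutionCost_le_of_substitutes (A := A) (T := centerSet s) (T' := centerSet s')
      ⟨_, mem_centerSet s ⟨0, hk⟩⟩ (a := 1 + 17 * e) (b := 5 * e * δ ^ 2) (fun c hc => by
        have : c ∈ Set.range s := by simpa [centerSet] using hc
        obtain ⟨i, rfl⟩ := this
        exact ⟨s' i, mem_centerSet s' i, hup i⟩)
    have := mul_le_mul_of_nonneg_left hsC (by positivity : 0 ≤ 5 * e)
    linarith

/-! ### Size of the net -/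

theorem net_card_le_pow {n : ℕ} (hn : 2 ≤ n) (M N : ℕ) :
    (n + n * ((n + n + 1) * (M + 1) * (3 * n) ^ N)) * n ≤ n ^ (6 + M + 3 * N) := by
  have h1 : n + n + 1 ≤ n ^ 3 := by nlinarith [Nat.mul_le_mul hn hn, pow_succ n 2]
  have h2 : M + 1 ≤ n ^ M := M.lt_two_pow_self.trans_le (Nat.pow_le_pow_left hn M)
  have h3 : (3 * n) ^ N ≤ n ^ (3 * N) := by
    rw [pow_mul]; exact Nat.pow_le_pow_left (by nlinarith [Nat.mul_le_mul hn hn, pow_succ n 2]) N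
  have h4 : n ≤ n ^ (4 + M + 3 * N) := Nat.le_self_pow (by omega) n
  calc (n + n * ((n + n + 1) * (M + 1) * (3 * n) ^ N)) * n
      ≤ (n ^ (4 + M + 3 * N) + n * (n ^ 3 * n ^ M * n ^ (3 * N))) * n := by gcongr
    _ = 2 * n ^ (5 + M + 3 * N) := by ring
    _ ≤ n * n ^ (5 + M + 3 * N) := by gcongr
    _ = _ := by ring

end KClustering

theorem mainTheorem7 :
    ∃ c : ℝ, 0 < c ∧ ∃ P : Polynomial ℝ,
      ∀ (d k : ℕ) (A : Finset (EuclideanSpace ℝ (Fin d))) (β ε : ℝ), 0 < β → 0 < ε →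
        ∃ F : Finset (EuclideanSpace ℝ (Fin d)),
          (F.card : ℝ) ≤ (A.card : ℝ) ^ (P.eval (1 / ε)) ∧
          ∀ (C : Fin k → Finset (EuclideanSpace ℝ (Fin d)))
            (s : Fin k → EuclideanSpace ℝ (Fin d)),
            KClustering.IsDistributionStable KClustering.sqCost A Set.univ k β C s →
            ∃ s' : Fin k → EuclideanSpace ℝ (Fin d),
              KClustering.IsDistributionStable KClustering.sqCost A
                (F : Set (EuclideanSpace ℝ (Fin d))) k (c * β) C s' ∧
              KClustering.clusteringCost KClustering.sqCost C s' ≤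
                (1 + ε) * KClustering.clusteringCost KClustering.sqCost C s ∧
              KClustering.solutionCost KClustering.sqCost A (KClustering.centerSet s') ≤
                (1 + ε) * KClustering.solutionCost KClustering.sqCost A
                  (KClustering.centerSet s) := by
  open KClustering in
  refine ⟨1 / 36, by norm_num, 10 + (100 * (1 + Polynomial.X)) ^ 3 +
    3 * (100 * (1 + Polynomial.X)) ^ 2, fun d k A β ε hβ hε => ?_⟩
  have hinv : 0 < 1 / ε := by positivity
  set Y : ℝ := 100 * (1 + 1 / ε) with hY
  have hP : (10 + (100 * (1 + Polynomial.X)) ^ 3 + 3 * (100 * (1 + Polynomial.X)) ^ 2 :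
      Polynomial ℝ).eval (1 / ε) = 10 + Y ^ 3 + 3 * Y ^ 2 := by
    simp [hY]
  rw [hP]
  have hcost : ∀ (C : Fin k → Finset (EuclideanSpace ℝ (Fin d))) s,
      0 ≤ clusteringCost sqCost C s := fun C s =>
    Finset.sum_nonneg fun _ _ => Finset.sum_nonneg fun _ _ => sq_nonneg _
  rcases lt_trichotomy A.card k with hlt | heq | hgt
  · -- a partition of `A` into more than `|A|` nonempty clusters does not exist
    refine ⟨∅, by simpa using Real.rpow_nonneg (Nat.cast_nonneg _) _, fun C s hs => ?_⟩
    obtain ⟨a, hinj, ha⟩ := hs.isClustering.exists_representatives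
    have := Finset.card_le_card_of_injOn (s := Finset.univ) (t := A) a
      (fun i _ => hs.isClustering.subset i (ha i)) hinj.injOn
    simp at this
    omega
  · refine ⟨A, ?_, fun C s hs => ?_⟩
    · rcases Nat.eq_zero_or_pos A.card with h0 | h0
      · rw [h0]; simpa using Real.rpow_nonneg le_rfl _
      · exact Real.self_le_rpow_of_one_le (by exact_mod_cast h0)
          (by have : 0 ≤ Y := by positivity
              have : 0 ≤ Y ^ 3 + 3 * Y ^ 2 := by positivity
              linarith)
    · obtain ⟨s', hst, h0⟩ := exists_singleton_centers heq hβ (by norm_num : (0 : ℝ) < 1 / 36)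
        hs.isClustering
      refine ⟨s', hst, ?_, ?_⟩
      · rw [h0]; exact mul_nonneg (by positivity) (hcost C s)
      · refine ((solutionCost_centerSet_le hs.isClustering s').trans h0.le).trans ?_
        exact mul_nonneg (by positivity) (solutionCost_nonneg _ _)
  · rcases Nat.eq_zero_or_pos k with hk | hk
    · -- no clustering of a nonempty set into zero clusters exists
      subst hk
      refine ⟨∅, by simpa using Real.rpow_nonneg (Nat.cast_nonneg _) _, fun C s hs => ?_⟩
      obtain ⟨x, hx⟩ := Finset.card_pos.1 hgt
      obtain ⟨i, -⟩ := (hs.isClustering.mem_iff x).1 hx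
      exact i.elim0
    -- the costs grow by the factor `1 + 22 * e`, and `exists_stable_net` needs `e ≤ 1 / 60`
    set e : ℝ := min ε 1 / 100 with he
    have hepos : 0 < e := by positivity
    have he1 : e ≤ 1 / 100 := by rw [he]; gcongr; exact min_le_right _ _
    have heε : 22 * e ≤ ε := by
      have := min_le_left ε 1
      have : e ≤ ε / 100 := by rw [he]; gcongr
      linarith
    have heY : 1 / e ≤ Y := by
      have hmin : 1 ≤ min ε 1 * (1 + 1 / ε) := by
        rcases min_cases ε 1 with ⟨h, -⟩ | ⟨h, -⟩ <;> rw [h]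
        · field_simp; linarith
        · linarith
      rw [div_le_iff₀ hepos, hY, he]
      linarith
    -- by Bernoulli's inequality `1 / e ^ 3` steps of the grid cover the window of a scale
    set M := ⌈1 / e ^ 3⌉₊ with hMdef
    set N := ⌊1 / e ^ 2⌋₊ + 1 with hNdef
    have hM : 1 ≤ e ^ 2 * (1 + e) ^ M := by
      have h1 : 1 / e ^ 3 ≤ M := Nat.le_ceil _
      rw [div_le_iff₀ (by positivity)] at h1
      have h2 := one_add_mul_le_pow (by linarith : -2 ≤ e) M
      have h3 := mul_le_mul_of_nonneg_left h2 (by positivity : 0 ≤ e ^ 2)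
      nlinarith [sq_nonneg e]
    have hN : 1 < N * e ^ 2 := by
      have h1 : 1 / e ^ 2 < N := by rw [hNdef]; push_cast; exact Nat.lt_floor_add_one _
      rwa [div_lt_iff₀ (by positivity)] at h1
    obtain ⟨F, hF, h⟩ := exists_stable_net hβ hepos (by linarith) hM hN hk hgt
    have hn2 : 2 ≤ A.card := by omega
    refine ⟨F, ?_, fun C s hs => ?_⟩
    · have h1 : (F.card : ℝ) ≤ (A.card : ℝ) ^ (6 + M + 3 * N) := by
        exact_mod_cast hF.trans (net_card_le_pow hn2 M N)
      refine h1.trans ?_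
      rw [← Real.rpow_natCast]
      refine Real.rpow_le_rpow_of_exponent_le (by exact_mod_cast (by omega : 1 ≤ A.card)) ?_
      have hpow : ∀ m : ℕ, 1 / e ^ m ≤ Y ^ m := fun m => by
        rw [← one_div_pow]; gcongr
      have hM' : (M : ℝ) ≤ Y ^ 3 + 1 :=
        (Nat.ceil_lt_add_one (by positivity)).le.trans (by linarith [hpow 3])
      have hN' : (N : ℝ) ≤ Y ^ 2 + 1 := by
        rw [hNdef]; push_cast
        linarith [Nat.floor_le (by positivity : 0 ≤ 1 / e ^ 2), hpow 2]
      push_cast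
      linarith
    · obtain ⟨s', hst, hc1, hc2⟩ := h C s hs
      refine ⟨s', hst, hc1.trans ?_, hc2.trans ?_⟩
      · exact mul_le_mul_of_nonneg_right (by linarith) (hcost C s)
      · exact mul_le_mul_of_nonneg_right (by linarith) (solutionCost_nonneg _ _)
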